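/- Let $X=\{x_0<x_1<\cdots<x_m\}$, $m\ge 0$, be an ordered alphabet, and let $L$ be the set of Lyndon words over $X$, i.e. of the nonempty words $\eta$ such that $\eta<\nu\xi$ in the lexicographic order for every factorization $\eta=\xi\nu$ into nonempty words. Let $L^\ast$ be the set of commutative monomials $l=l_{i_1}\cdots l_{i_k}$, $k\ge 0$, in the elements of $L$, with degree $|l|=|l_{i_1}|+\cdots+|l_{i_k}|$ (the sum of the lengths of the words over $X$), and let $\mathscr{L}^{-1}(l)=l_{i_1}\,\sqcup\!\sqcup\cdots\sqcup\!\sqcup\, l_{i_k}\in\mathbb{R}\langle X\rangle$ be the shuffle product of the words $l_{i_1},\dots,l_{i_k}$ (the empty word if $k=0$). For $u=(u_1,\dots,u_m)\in L_1^m[t_0,t_1]$ put $u_0=1$ and define the iterated integrals $E_\emptyset[u]=1$, $E_{x_i\eta}[u](t,t_0)=\int_{t_0}^t u_i(\tau)E_\eta[u](\tau,t_0)\,d\tau$, extended linearly to polynomials: $E_p=\sum_\eta (p,\eta)E_\eta$. Let $B_1^m(R)[t_0,t_1]$ be the set of measurable $u:[t_0,t_1]\to\mathbb{R}^m$ with $\max_i\|u_i\|_{L_1[t_0,t_1]}\le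 R$. **Theorem.** Let $c_L=\sum_{l\in L^\ast}(c_L,l)\,l$ be a formal power series with real coefficients in the commuting variables $L$ (a constant term is allowed), and suppose that for some real numbers $K_L,M_L>0$ $$|(c_L,l)|\le K_L M_L^{|l|}\qquad\text{for all } l\in L^\ast .$$ Then there exist real numbers $R_L,\Delta_L>0$ such that for every $t_0\in\mathbb{R}$ and every $u\in B_1^m(R_L)[t_0,t_0+\Delta_L]$ the series $$F_{c_L}[u](t)=\sum_{l\in L^\ast}(c_L,l)\,E_{\mathscr{L}^{-1}(l)}[u](t,t_0)$$ converges absolutely and uniformly on $[t_0,t_0+\Delta_L]$. -/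

import Mathlib

open MeasureTheory Set

noncomputable section

namespace ChenFliess

/-- Words over the alphabet `X = {x_0, …, x_m}`; the letter `x_i` is `i : Fin (m + 1)`. -/
abbrev Word (m : ℕ) := List (Fin (m + 1))

/-- Noncommutative polynomials over `X`: finitely supported real functions on words. -/
abbrev WordPoly (m : ℕ) := Word m →₀ ℝ

/-- `η` is a Lyndon word: it is nonempty, and `η < ν ξ` in the lexicographic order for every
factorization `η = ξ ν` into nonempty words. -/
def IsLyndon {m : ℕ} (η : Word m) : Prop :=
  η ≠ [] ∧ ∀ ξ ν : Word m, ξ ≠ [] → ν ≠ [] → η = ξ ++ ν → η < ν ++ ξ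

/-- The set `L` of Lyndon words over `X`. -/
abbrev LyndonWord (m : ℕ) := {η : Word m // IsLyndon η}

/-- `L^*`: commutative monomials in the Lyndon words (the empty monomial included). -/
abbrev LyndonMonomial (m : ℕ) := LyndonWord m →₀ ℕ

/-- The degree `|l| = |(l_{i_1})| + ⋯ + |(l_{i_k})|` of `l = l_{i_1} ⋯ l_{i_k}`, that is, the total
length over the alphabet `X`. -/
def lyndonDegree {m : ℕ} (l : LyndonMonomial m) : ℕ :=
  l.sum fun w n => n * w.1.length

/-- Left concatenation of a polynomial with a letter. -/
def consPoly {m : ℕ} (x : Fin (m + 1)) (p : WordPoly m) : WordPoly m :=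
  p.mapDomain (fun η => x :: η)

/-- The shuffle product of two words. -/
def shuffleWord {m : ℕ} : Word m → Word m → WordPoly m
  | [], η => Finsupp.single η 1
  | x :: ξ, [] => Finsupp.single (x :: ξ) 1
  | x :: ξ, y :: η =>
      consPoly x (shuffleWord ξ (y :: η)) + consPoly y (shuffleWord (x :: ξ) η)
  termination_by ξ η => ξ.length + η.length

/-- The shuffle product of two polynomials: the bilinear extension of `shuffleWord`. -/
def shuffle {m : ℕ} (p q : WordPoly m) : WordPoly m :=
  p.sum fun ξ a => q.sum fun η b => (a * b) • shuffleWord ξ η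

/-- The shuffle product of a list of words (the empty word if the list is empty). -/
def shuffleList {m : ℕ} : List (Word m) → WordPoly m
  | [] => Finsupp.single [] 1
  | w :: ws => shuffle (Finsupp.single w 1) (shuffleList ws)

/-- The inverse of the Lyndon isomorphism (from the shuffle algebra over `X` to the commutative
polynomials in `L`, which sends each Lyndon word to the corresponding variable), evaluated at a
monomial: `l_{i_1} ⋯ l_{i_k}` with `l_{i_1} ≥ ⋯ ≥ l_{i_k}` goes to the shuffle product of the words
`(l_{i_1}), …, (l_{i_k})`. -/
def lyndonInv {m : ℕ} (l : LyndonMonomial m) : WordPoly m :=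
  shuffleList (((Finsupp.toMultiset l).sort (· ≥ ·)).map Subtype.val)

/-- The input `u = (u_1, …, u_m)` extended by `u_0 = 1`. -/
def extInput {m : ℕ} (u : ℝ → Fin m → ℝ) (τ : ℝ) : Fin (m + 1) → ℝ :=
  Fin.cons 1 (u τ)

/-- The iterated integral `E_η[u](t, t₀)`. -/
def iterInt {m : ℕ} (u : ℝ → Fin m → ℝ) (t₀ : ℝ) : Word m → ℝ → ℝ
  | [], _ => 1
  | i :: η, t => ∫ τ in t₀..t, extInput u τ i * iterInt u t₀ η τ

/-- Linear extension `E_p[u](t, t₀) = ∑_η (p, η) E_η[u](t, t₀)` to polynomials `p`. -/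
def iterIntPoly {m : ℕ} (u : ℝ → Fin m → ℝ) (t₀ : ℝ) (p : WordPoly m) (t : ℝ) : ℝ :=
  p.sum fun η a => a * iterInt u t₀ η t

/-- `‖u‖_p = max_i ‖u_i‖_p` on `[t₀, t₁]`. -/
def inputNorm {m : ℕ} (p : ENNReal) (u : ℝ → Fin m → ℝ) (t₀ t₁ : ℝ) : ENNReal :=
  ⨆ i, eLpNorm (fun τ => u τ i) p (volume.restrict (Icc t₀ t₁))

/-- The ball `B_p^m(R)[t₀, t₁]`: functions, Lebesgue measurable on `[t₀, t₁]`, with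
`‖u‖_p ≤ R` there. Values outside `[t₀, t₁]` are irrelevant. -/
def inputBall (m : ℕ) (p : ENNReal) (R t₀ t₁ : ℝ) : Set (ℝ → Fin m → ℝ) :=
  {u | (∀ i, MemLp (fun τ => u τ i) p (volume.restrict (Icc t₀ t₁))) ∧
    inputNorm p u t₀ t₁ ≤ ENNReal.ofReal R}

/-- The term of `F_c[u](t)` indexed by the Lyndon monomial `l`. -/
def lyndonTerm {m : ℕ} (c : MvPowerSeries (LyndonWord m) ℝ) (u : ℝ → Fin m → ℝ) (t₀ : ℝ)
    (l : LyndonMonomial m) (t : ℝ) : ℝ :=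
  MvPowerSeries.coeff l c * iterIntPoly u t₀ (lyndonInv l) t

/-- The Chen–Fliess series `F_c[u](t)` indexed by Lyndon monomials. -/
def lyndonSeries {m : ℕ} (c : MvPowerSeries (LyndonWord m) ℝ) (u : ℝ → Fin m → ℝ) (t₀ t : ℝ) : ℝ :=
  ∑' l : LyndonMonomial m, lyndonTerm c u t₀ l t

end ChenFliess

end

/-! By integration by parts, iterated integrals turn shuffle products into pointwise products
(`iterIntPoly_shuffle`), so the integral attached to a Lyndon monomial is the product of those of
its factors. If `ρ` bounds the `L¹` norm of every extended input, including the constant `u₀ = 1`,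
each word contributes at most `ρ ^ length`, and the term of `l` is at most `K * (M * ρ) ^ |l|`.

It remains to sum `r ^ |l|` over monomials. Formally this is the Euler product of `1 / (1 - r ^
|w|)` over Lyndon words `w`, which converges because `∑ r ^ |w|` over all words does when `(m + 1) *
r < 1`. The Weierstrass M-test concludes. -/

namespace ChenFliess

/-! ### Counting monomials by degree -/

section Counting

/-- Words over a finite alphabet have a convergent generating function for small arguments. -/
theorem summable_pow_length {α : Type*} [Fintype α] {r : ℝ} (hr : 0 ≤ r)
    (h : Fintype.card α * r < 1) : Summable fun w : List α => r ^ w.length := by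
  rw [← (Equiv.sigmaFiberEquiv (List.length : List α → ℕ)).summable_iff,
    summable_sigma_of_nonneg (fun _ => by simp only [Function.comp]; positivity)]
  have key : ∀ n : ℕ, ∀ w : {w : List α // w.length = n},
      ((fun w : List α => r ^ w.length) ∘ Equiv.sigmaFiberEquiv List.length) ⟨n, w⟩ = r ^ n := by
    rintro n ⟨w, rfl⟩
    simp [Equiv.sigmaFiberEquiv]
  have card : ∀ n : ℕ, Nat.card {w : List α // w.length = n} = Fintype.card α ^ n := fun n => by
    rw [← card_vector n, ← Nat.card_eq_fintype_card]; rfl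
  have fin : ∀ n : ℕ, Finite {w : List α // w.length = n} := fun n =>
    inferInstanceAs (Finite (List.Vector α n))
  refine ⟨fun n => ?_, ?_⟩
  · have := fin n
    exact Summable.of_finite
  · simp_rw [key, tsum_const, card, nsmul_eq_mul, Nat.cast_pow, ← mul_pow]
    exact summable_geometric_of_lt_one (by positivity) h

/-- If `∑ f` converges and `0 ≤ f ≤ 1/2`, then the sum over all monomials in the variables `α`
of the products of the `f a` converges. -/
theorem summable_finsupp_prod_pow {α : Type*} {f : α → ℝ} (h0 : ∀ a, 0 ≤ f a)
    (h2 : ∀ a, f a ≤ 1 / 2) (hf : Summable f) :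
    Summable fun l : α →₀ ℕ => l.prod fun a n => f a ^ n := by
  classical
  refine summable_of_sum_le (c := Real.exp (∑' a, 2 * f a))
    (fun l => Finset.prod_nonneg fun a _ => pow_nonneg (h0 a) _) fun T => ?_
  -- The finite family `T` lies in a box: variables in `S`, exponents below `N`. The sum over the
  -- box factors into truncated geometric series.
  set S : Finset α := T.biUnion Finsupp.support
  set N : ℕ := (T.sup fun l => l.sum fun _ n => n) + 1
  have hS : ∀ l ∈ T, l.support ⊆ S := fun l hl => Finset.subset_biUnion_of_mem Finsupp.support hl
  have hN : ∀ l ∈ T, ∀ a, l a < N := fun l hl a => by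
    refine Nat.lt_succ_of_le (le_trans ?_ (Finset.le_sup (f := fun l : α →₀ ℕ =>
      l.sum fun _ n => n) hl))
    by_cases ha : a ∈ l.support
    · exact Finset.single_le_sum (f := fun a => l a) (fun _ _ => Nat.zero_le _) ha
    · simp [Finsupp.notMem_support_iff.mp ha]
  calc ∑ l ∈ T, l.prod (fun a n => f a ^ n)
      = ∑ l ∈ T, ∏ a : S, f a ^ (l a) := by
        refine Finset.sum_congr rfl fun l hl => ?_
        rw [Finsupp.prod_of_support_subset l (hS l hl) _ (by simp),
          ← Finset.prod_coe_sort S fun a => f a ^ l a]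
    _ = ∑ p ∈ T.image (fun l (a : S) => l a), ∏ a : S, f a ^ (p a) := by
        rw [Finset.sum_image]
        intro l hl l' hl' h
        ext a
        by_cases ha : a ∈ S
        · exact congrFun h ⟨a, ha⟩
        · rw [Finsupp.notMem_support_iff.mp fun h => ha (hS l hl h),
            Finsupp.notMem_support_iff.mp fun h => ha (hS l' hl' h)]
    _ ≤ ∑ p ∈ Fintype.piFinset (fun _ : S => Finset.range N), ∏ a : S, f a ^ (p a) := by
        refine Finset.sum_le_sum_of_subset_of_nonneg ?_
          fun p _ _ => Finset.prod_nonneg fun a _ => pow_nonneg (h0 a) _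
        intro p hp
        obtain ⟨l, hl, rfl⟩ := Finset.mem_image.mp hp
        simpa using fun a _ => hN l hl a
    _ = ∏ a : S, ∑ n ∈ Finset.range N, f a ^ n := (Finset.prod_univ_sum _ _).symm
    _ ≤ ∏ a : S, (1 + 2 * f a) := by
        refine Finset.prod_le_prod
          (fun a _ => Finset.sum_nonneg fun n _ => pow_nonneg (h0 a) _) fun a _ => ?_
        have h1 : f a < 1 := by linarith [h2 a]
        refine ((summable_geometric_of_lt_one (h0 a) h1).sum_le_tsum _
          fun n _ => pow_nonneg (h0 a) n).trans ?_
        -- `1 / (1 - x) ≤ 1 + 2 * x` holds on `[0, 1/2]`, hence the hypothesis `f a ≤ 1 / 2`.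
        rw [tsum_geometric_of_lt_one (h0 a) h1, inv_le_iff_one_le_mul₀ (by linarith)]
        nlinarith [h0 a, h2 a]
    _ = ∏ a ∈ S, (1 + 2 * f a) := Finset.prod_coe_sort S fun a => 1 + 2 * f a
    _ ≤ Real.exp (∑ a ∈ S, 2 * f a) :=
        Real.prod_one_add_le_exp_sum S fun a => by linarith [h0 a]
    _ ≤ Real.exp (∑' a, 2 * f a) := Real.exp_le_exp.mpr
        ((hf.mul_left 2).sum_le_tsum S fun a _ => by linarith [h0 a])

theorem lyndonDegree_pow {m : ℕ} (r : ℝ) (l : LyndonMonomial m) :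
    r ^ lyndonDegree l = l.prod fun w n => (r ^ w.1.length) ^ n := by
  simp only [lyndonDegree, Finsupp.sum, Finsupp.prod, ← Finset.prod_pow_eq_pow_sum, ← pow_mul,
    mul_comm]

theorem summable_pow_lyndonDegree (m : ℕ) {r : ℝ} (hr : 0 ≤ r) (hr2 : r ≤ 1 / 2)
    (h : (m + 1) * r < 1) : Summable fun l : LyndonMonomial m => r ^ lyndonDegree l := by
  simp_rw [lyndonDegree_pow]
  refine summable_finsupp_prod_pow (fun w => by positivity) (fun w => ?_) ?_
  -- Of the Lyndon property only nonemptiness matters: it gives `r ^ |w| ≤ r`.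
  · exact (pow_le_of_le_one hr (by linarith) (List.length_pos_iff.mpr w.2.1).ne').trans hr2
  · exact (summable_pow_length (α := Fin (m + 1)) hr (by simpa using h)).comp_injective
      Subtype.val_injective

end Counting

/-! ### Shuffle identity and bounds for iterated integrals -/

section IteratedIntegrals

variable {m : ℕ} {u : ℝ → Fin m → ℝ} {a b : ℝ}

theorem continuousOn_iterInt
    (hv : ∀ i, IntervalIntegrable (fun τ => extInput u τ i) volume a b) (η : Word m) :
    ContinuousOn (iterInt u a η) (uIcc a b) := by
  induction η with
  | nil => exact continuousOn_const
  | cons i η ih =>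
    exact intervalIntegral.continuousOn_primitive_interval'
      ((hv i).mul_continuousOn ih) left_mem_uIcc

theorem intervalIntegrable_mul_iterInt
    (hv : ∀ i, IntervalIntegrable (fun τ => extInput u τ i) volume a b) (i : Fin (m + 1))
    (η : Word m) {t : ℝ} (ht : t ∈ uIcc a b) :
    IntervalIntegrable (fun τ => extInput u τ i * iterInt u a η τ) volume a t :=
  ((hv i).mul_continuousOn (continuousOn_iterInt hv η)).mono_set (uIcc_subset_uIcc_left ht)

theorem iterIntPoly_zero (t : ℝ) : iterIntPoly u a 0 t = 0 := Finsupp.sum_zero_index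

theorem iterIntPoly_add (p q : WordPoly m) (t : ℝ) :
    iterIntPoly u a (p + q) t = iterIntPoly u a p t + iterIntPoly u a q t :=
  Finsupp.sum_add_index' (by simp) (by intros; ring)

theorem iterIntPoly_single (η : Word m) (c t : ℝ) :
    iterIntPoly u a (Finsupp.single η c) t = c * iterInt u a η t :=
  Finsupp.sum_single_index (by simp)

theorem iterIntPoly_smul (c : ℝ) (p : WordPoly m) (t : ℝ) :
    iterIntPoly u a (c • p) t = c * iterIntPoly u a p t := by
  rw [iterIntPoly, iterIntPoly, Finsupp.sum_smul_index (by simp), Finsupp.mul_sum]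
  simp only [mul_assoc]

theorem iterIntPoly_sum {ι : Type*} (s : Finset ι) (p : ι → WordPoly m) (t : ℝ) :
    iterIntPoly u a (∑ j ∈ s, p j) t = ∑ j ∈ s, iterIntPoly u a (p j) t := by
  classical
  induction s using Finset.induction_on with
  | empty => simp [iterIntPoly_zero]
  | insert j s hj ih => rw [Finset.sum_insert hj, Finset.sum_insert hj, iterIntPoly_add, ih]

theorem iterIntPoly_consPoly
    (hv : ∀ i, IntervalIntegrable (fun τ => extInput u τ i) volume a b) (i : Fin (m + 1))
    (p : WordPoly m) {t : ℝ} (ht : t ∈ uIcc a b) :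
    iterIntPoly u a (consPoly i p) t = ∫ τ in a..t, extInput u τ i * iterIntPoly u a p τ := by
  simp only [iterIntPoly, Finsupp.sum, Finset.mul_sum]
  rw [intervalIntegral.integral_finsetSum]
  · rw [consPoly]
    refine (Finsupp.sum_mapDomain_index (h := fun η c => c * iterInt u a η t) (by simp)
      (by intros; ring)).trans (Finset.sum_congr rfl fun η _ => ?_)
    simp only [iterInt, ← intervalIntegral.integral_const_mul]
    exact intervalIntegral.integral_congr fun τ _ => by ring
  · intro η _
    simpa only [mul_left_comm] using (intervalIntegrable_mul_iterInt hv i η ht).const_mul (p η)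

/-- The product rule for primitives of integrable functions. -/
theorem primitive_mul_primitive {f g : ℝ → ℝ} {a t : ℝ} (hf : IntervalIntegrable f volume a t)
    (hg : IntervalIntegrable g volume a t) :
    (∫ τ in a..t, f τ) * ∫ τ in a..t, g τ =
      (∫ τ in a..t, f τ * ∫ σ in a..τ, g σ) + ∫ τ in a..t, g τ * ∫ σ in a..τ, f σ := by
  -- Inputs are only integrable, so the primitives are absolutely continuous and differentiable
  -- merely almost everywhere.
  have hF := hf.absolutelyContinuousOnInterval_intervalIntegral left_mem_uIcc
  have hG := hg.absolutelyContinuousOnInterval_intervalIntegral left_mem_uIcc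
  have key := hF.integral_deriv_mul_eq_sub hG
  simp only [intervalIntegral.integral_same, zero_mul, sub_zero] at key
  rw [← key, ← intervalIntegral.integral_add (hf.mul_continuousOn hG.continuousOn)
    (hg.mul_continuousOn hF.continuousOn)]
  refine intervalIntegral.integral_congr_ae ?_
  filter_upwards [hf.ae_hasDerivAt_integral, hg.ae_hasDerivAt_integral] with x hx hx' hxm
  have hxm := uIoc_subset_uIcc hxm
  rw [(hx hxm a left_mem_uIcc).deriv, (hx' hxm a left_mem_uIcc).deriv]
  ring

/-- Iterated integrals turn shuffle products of words into products. -/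
theorem iterIntPoly_shuffleWord
    (hv : ∀ i, IntervalIntegrable (fun τ => extInput u τ i) volume a b) (ξ η : Word m) :
    ∀ t ∈ uIcc a b,
      iterIntPoly u a (shuffleWord ξ η) t = iterInt u a ξ t * iterInt u a η t := by
  induction ξ, η using shuffleWord.induct with
  | case1 η => intro t _; simp [shuffleWord, iterIntPoly_single, iterInt]
  | case2 x ξ => intro t _; simp [shuffleWord, iterIntPoly_single, iterInt]
  | case3 x ξ y η ih₁ ih₂ =>
    intro t ht
    have hsub := uIcc_subset_uIcc_left ht
    -- The two branches of the shuffle recursion are the two terms of the product rule.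
    rw [shuffleWord, iterIntPoly_add, iterIntPoly_consPoly hv x _ ht,
      iterIntPoly_consPoly hv y _ ht]
    refine Eq.trans ?_ (primitive_mul_primitive (intervalIntegrable_mul_iterInt hv x ξ ht)
      (intervalIntegrable_mul_iterInt hv y η ht)).symm
    congr 1
    · refine intervalIntegral.integral_congr fun τ hτ => ?_
      simp only [ih₁ τ (hsub hτ), iterInt, mul_assoc]
    · refine intervalIntegral.integral_congr fun τ hτ => ?_
      simp only [ih₂ τ (hsub hτ), iterInt]
      ring

/-- Iterated integrals turn shuffle products into products. -/
theorem iterIntPoly_shuffle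
    (hv : ∀ i, IntervalIntegrable (fun τ => extInput u τ i) volume a b) (p q : WordPoly m)
    {t : ℝ} (ht : t ∈ uIcc a b) :
    iterIntPoly u a (shuffle p q) t = iterIntPoly u a p t * iterIntPoly u a q t := by
  simp only [shuffle, Finsupp.sum, iterIntPoly_sum, iterIntPoly_smul,
    iterIntPoly_shuffleWord hv _ _ t ht]
  simp only [iterIntPoly, Finsupp.sum, Finset.sum_mul_sum]
  exact Finset.sum_congr rfl fun _ _ => Finset.sum_congr rfl fun _ _ => by ring

theorem iterIntPoly_shuffleList
    (hv : ∀ i, IntervalIntegrable (fun τ => extInput u τ i) volume a b) (ws : List (Word m))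
    {t : ℝ} (ht : t ∈ uIcc a b) :
    iterIntPoly u a (shuffleList ws) t = (ws.map fun w => iterInt u a w t).prod := by
  induction ws with
  | nil => simp [shuffleList, iterIntPoly_single, iterInt]
  | cons w ws ih =>
    rw [shuffleList, iterIntPoly_shuffle hv _ _ ht, ih, iterIntPoly_single, one_mul,
      List.map_cons, List.prod_cons]

/-- Multiplication of reals commutes, so the sorting in `lyndonInv` leaves no trace. -/
theorem iterIntPoly_lyndonInv
    (hv : ∀ i, IntervalIntegrable (fun τ => extInput u τ i) volume a b) (l : LyndonMonomial m)
    {t : ℝ} (ht : t ∈ uIcc a b) :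
    iterIntPoly u a (lyndonInv l) t = l.prod fun w n => iterInt u a w.1 t ^ n := by
  rw [lyndonInv, iterIntPoly_shuffleList hv _ ht, List.map_map, ← Multiset.prod_coe,
    ← Multiset.map_coe, Multiset.sort_eq, Finsupp.toMultiset_map, Finsupp.prod_toMultiset,
    Finsupp.prod_mapDomain_index (by simp) (by intros; ring)]
  rfl

/-- Each letter costs one factor `ρ`; no factorial gain is needed. -/
theorem abs_iterInt_le (hab : a ≤ b)
    (hv : ∀ i, IntervalIntegrable (fun τ => extInput u τ i) volume a b) {ρ : ℝ}
    (hρ : ∀ i, ∫ τ in a..b, |extInput u τ i| ≤ ρ) (η : Word m) :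
    ∀ t ∈ Icc a b, |iterInt u a η t| ≤ ρ ^ η.length := by
  have hρ0 : 0 ≤ ρ :=
    (intervalIntegral.integral_nonneg hab fun _ _ => abs_nonneg _).trans (hρ 0)
  induction η with
  | nil => intro t _; simp [iterInt]
  | cons i η ih =>
    intro t ht
    have ht' : t ∈ uIcc a b := Icc_subset_uIcc ht
    have hvt := (hv i).mono_set (uIcc_subset_uIcc_left ht')
    calc |iterInt u a (i :: η) t|
        ≤ ∫ τ in a..t, |extInput u τ i * iterInt u a η τ| :=
          intervalIntegral.abs_integral_le_integral_abs ht.1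
      _ ≤ ∫ τ in a..t, |extInput u τ i| * ρ ^ η.length := by
          refine intervalIntegral.integral_mono_on ht.1
            (intervalIntegrable_mul_iterInt hv i η ht').abs (hvt.abs.mul_const _) fun τ hτ => ?_
          rw [abs_mul]
          exact mul_le_mul_of_nonneg_left (ih τ ⟨hτ.1, hτ.2.trans ht.2⟩) (abs_nonneg _)
      _ = (∫ τ in a..t, |extInput u τ i|) * ρ ^ η.length :=
          intervalIntegral.integral_mul_const _ _
      _ ≤ ρ * ρ ^ η.length := by
          refine mul_le_mul_of_nonneg_right (le_trans ?_ (hρ i)) (pow_nonneg hρ0 _)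
          exact intervalIntegral.integral_mono_interval le_rfl ht.1 ht.2
            (Filter.Eventually.of_forall fun _ => abs_nonneg _) (hv i).abs
      _ = ρ ^ (i :: η).length := by rw [List.length_cons, pow_succ']

theorem abs_iterIntPoly_lyndonInv_le (hab : a ≤ b)
    (hv : ∀ i, IntervalIntegrable (fun τ => extInput u τ i) volume a b) {ρ : ℝ}
    (hρ : ∀ i, ∫ τ in a..b, |extInput u τ i| ≤ ρ) (l : LyndonMonomial m) {t : ℝ}
    (ht : t ∈ Icc a b) : |iterIntPoly u a (lyndonInv l) t| ≤ ρ ^ lyndonDegree l := by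
  rw [iterIntPoly_lyndonInv hv l (Icc_subset_uIcc ht), lyndonDegree_pow, Finsupp.prod,
    Finset.abs_prod]
  refine Finset.prod_le_prod (fun _ _ => abs_nonneg _) fun w _ => ?_
  rw [abs_pow]
  exact pow_le_pow_left₀ (abs_nonneg _) (abs_iterInt_le hab hv hρ w.1 t ht) _

theorem intervalIntegrable_extInput {R : ℝ} (hab : a ≤ b) (hu : u ∈ inputBall m 1 R a b)
    (i : Fin (m + 1)) : IntervalIntegrable (fun τ => extInput u τ i) volume a b := by
  refine Fin.cases ?_ (fun j => ?_) i
  · simp [extInput]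
  · rw [intervalIntegrable_iff_integrableOn_Icc_of_le hab]
    exact memLp_one_iff_integrable.mp (hu.1 j)

theorem integral_abs_extInput_le {R : ℝ} (hab : a ≤ b) (hR : b - a ≤ R)
    (hu : u ∈ inputBall m 1 R a b) (i : Fin (m + 1)) :
    ∫ τ in a..b, |extInput u τ i| ≤ R := by
  refine Fin.cases ?_ (fun j => ?_) i
  -- The letter `x₀` has `L¹` norm `b - a`, so the interval must be short too.
  · simpa [extInput] using hR
  · have h := (le_iSup (fun i => eLpNorm (fun τ => u τ i) 1 (volume.restrict (Icc a b))) j).trans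
      hu.2
    rw [intervalIntegral.integral_of_le hab, ← integral_Icc_eq_integral_Ioc]
    change ∫ τ in Icc a b, ‖u τ j‖ ≤ R
    rw [integral_norm_eq_lintegral_enorm (hu.1 j).aestronglyMeasurable,
      ← eLpNorm_one_eq_lintegral_enorm]
    exact ENNReal.toReal_le_of_le_ofReal ((sub_nonneg.mpr hab).trans hR) h

end IteratedIntegrals

end ChenFliess

theorem mainTheorem5 (m : ℕ) (c : MvPowerSeries (ChenFliess.LyndonWord m) ℝ) (K M : ℝ)
    (hK : 0 < K) (hM : 0 < M)
    (hc : ∀ l : ChenFliess.LyndonMonomial m,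
      |MvPowerSeries.coeff l c| ≤ K * M ^ ChenFliess.lyndonDegree l) :
    ∃ R Δ : ℝ, 0 < R ∧ 0 < Δ ∧
      ∀ t₀ : ℝ, ∀ u ∈ ChenFliess.inputBall m 1 R t₀ (t₀ + Δ),
        (∀ t ∈ Set.Icc t₀ (t₀ + Δ), Summable fun l => |ChenFliess.lyndonTerm c u t₀ l t|) ∧
        HasSumUniformlyOn (ChenFliess.lyndonTerm c u t₀) (ChenFliess.lyndonSeries c u t₀)
          (Set.Icc t₀ (t₀ + Δ)) := by
  have hρ : 0 < 1 / (2 * (m + 1) * M) := by positivity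
  -- Chosen so that `(m + 1) * (M * ρ) = 1 / 2`; it serves as both radius and duration.
  set ρ : ℝ := 1 / (2 * (m + 1) * M) with hρ_def
  refine ⟨ρ, ρ, hρ, hρ, fun t₀ u hu => ?_⟩
  have hab : t₀ ≤ t₀ + ρ := by linarith
  have hr : (m + 1) * (M * ρ) = 1 / 2 := by
    rw [hρ_def]; field_simp
  have hr2 : M * ρ ≤ 1 / 2 := by
    rw [← hr]
    exact le_mul_of_one_le_left (by positivity) (by simp)
  have hsum : Summable fun l : ChenFliess.LyndonMonomial m =>
      K * (M * ρ) ^ ChenFliess.lyndonDegree l :=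
    (ChenFliess.summable_pow_lyndonDegree m (by positivity) hr2 (by rw [hr]; norm_num)).mul_left K
  have hbound : ∀ l, ∀ t ∈ Set.Icc t₀ (t₀ + ρ),
      |ChenFliess.lyndonTerm c u t₀ l t| ≤ K * (M * ρ) ^ ChenFliess.lyndonDegree l := by
    intro l t ht
    rw [ChenFliess.lyndonTerm, abs_mul, mul_pow, ← mul_assoc]
    exact mul_le_mul (hc l) (ChenFliess.abs_iterIntPoly_lyndonInv_le hab
      (ChenFliess.intervalIntegrable_extInput hab hu)
      (ChenFliess.integral_abs_extInput_le hab (by linarith) hu) l ht)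
      (abs_nonneg _) (by positivity)
  exact ⟨fun t ht => Summable.of_nonneg_of_le (fun _ => abs_nonneg _) (fun l => hbound l t ht) hsum,
    HasSumUniformlyOn.of_norm_le_summable hsum hbound⟩
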